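/- Let $n \ge 1$ and let $(X_1,\mu_1),\dots,(X_n,\mu_n)$ be $\sigma$-finite measure spaces with product space $(X,\mu)$. A double $n$-tuple $$Q=\begin{pmatrix} q_1 & \cdots & q_n\\ x_{\pi(1)} & \cdots & x_{\pi(n)}\end{pmatrix},\qquad q_j\in(0,\infty],\ \pi\in S_n,$$ defines, for measurable $f:X\to[0,\infty]$, the mixed norm $\|f\|_Q$ obtained by taking successively the $L^{q_1}(\mu_{\pi(1)})$ norm in the variable $x_{\pi(1)}$ (innermost), then the $L^{q_2}(\mu_{\pi(2)})$ norm in $x_{\pi(2)}$, and so on up to the $L^{q_n}(\mu_{\pi(n)})$ norm in $x_{\pi(n)}$ (outermost), where the $L^\infty$ norm is the essential supremum. Let $P$ be a double $n$-tuple with exponents $p_1\ge p_2\ge\cdots\ge p_n$ in $(0,\infty]$ and let $\overline p=\left(\frac1n\sum_{j=1}^n p_j^{-1}\right)^{-1}$ be their harmonic mean (with $1/\infty=0$ and $1/0=\infty$). For $\sigma\in S_n$ let $P_\sigma$ be obtained from $P$ by permuting the variables in the bottom row by $\sigma$ while keeping the exponents in place, and let $P^\sigma$ be obtained by permuting the exponents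 in the top row by $\sigma$ while keeping the variables in place. Identify double $n$-tuples which differ only in the order of the variables within blocks of consecutive equal exponents, and let $P_1,\dots,P_m$ enumerate, without repetition, the orbit $\{P_\sigma:\sigma\in S_n\}$ modulo this identification. Then $m$ is equal to the number of elements of the orbit $\{P^\sigma:\sigma\in S_n\}$, and for any measurable functions $f_1,\dots,f_m:X\to[0,\infty]$, $$\left\|\prod_{i=1}^m f_i^{1/m}\right\|_{L^{\overline p}(X)}\le\prod_{i=1}^m\|f_i\|_{P_i}^{1/m},$$ with the convention $0\cdot\infty=0$ in products. -/

import Mathlib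

open MeasureTheory
open scoped ENNReal

/-- A double `n`-tuple: the top row lists exponents `p_1, …, p_n ∈ (0, ∞]`, the bottom row lists
the variables `x_1, …, x_n`, each exactly once, in some order. Column `j` says that the `j`-th
norm to be taken (counting from the innermost) is the `L^{exps j}` norm in the variable
`x_{vars j}`. -/
@[ext]
structure DoubleTuple (n : ℕ) where
  exps : Fin n → ℝ≥0∞
  vars : Equiv.Perm (Fin n)
  exps_pos : ∀ j, 0 < exps j

namespace DoubleTuple

variable {n : ℕ}

/-- `P_σ`: the exponents stay in place, the variables are permuted. -/
def permVars (P : DoubleTuple n) (σ : Equiv.Perm (Fin n)) : DoubleTuple n where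
  exps := P.exps
  vars := P.vars * σ
  exps_pos := P.exps_pos

/-- `P^σ`: the variables stay in place, the exponents are permuted. -/
def permExps (P : DoubleTuple n) (σ : Equiv.Perm (Fin n)) : DoubleTuple n where
  exps := fun j => P.exps (σ j)
  vars := P.vars
  exps_pos := fun j => P.exps_pos (σ j)

/-- The harmonic mean of the exponents, as an element of `[0, ∞]` (with `1/∞ = 0`, `1/0 = ∞`). -/
noncomputable def harmonicMean (P : DoubleTuple n) : ℝ≥0∞ :=
  ((n : ℝ≥0∞)⁻¹ * ∑ j, (P.exps j)⁻¹)⁻¹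

/-- `P` and `Q` differ only in the order of the variables within blocks of consecutive equal
exponents: they have the same exponents, and the variables of `Q` are those of `P` rearranged by
a permutation `τ` of positions such that all positions from `j` to `τ j` carry the same exponent. -/
def BlockEquiv (P Q : DoubleTuple n) : Prop :=
  P.exps = Q.exps ∧ ∃ τ : Equiv.Perm (Fin n),
    (∀ j, ∀ k ∈ Set.uIcc j (τ j), P.exps k = P.exps j) ∧ Q.vars = P.vars * τ

theorem blockEquiv_equivalence : Equivalence (BlockEquiv (n := n)) where
  refl P := ⟨rfl, 1, by intro j k hk; simp at hk; rw [hk], by simp⟩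
  symm := by
    rintro P Q ⟨he, τ, hτ, hv⟩
    refine ⟨he.symm, τ⁻¹, ?_, by rw [hv]; simp⟩
    intro j k hk
    have h := hτ (τ⁻¹ j)
    have e : τ (τ⁻¹ j) = j := τ.apply_symm_apply j
    rw [e] at h
    rw [← he, h k (by rwa [Set.uIcc_comm]), h j Set.right_mem_uIcc]
  trans := by
    rintro P Q R ⟨he, τ, hτ, hv⟩ ⟨he', ρ, hρ, hv'⟩
    refine ⟨he.trans he', τ * ρ, ?_, by rw [hv', hv, mul_assoc]⟩
    intro j k hk
    rw [← he] at hρ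
    rw [Equiv.Perm.mul_apply] at hk
    rcases Set.uIcc_subset_uIcc_union_uIcc (b := ρ j) hk with h | h
    · exact hρ j k h
    · rw [hτ (ρ j) k h, hρ j (ρ j) Set.right_mem_uIcc]

/-- The identification of double `n`-tuples up to reordering of variables within blocks. -/
def blockSetoid (n : ℕ) : Setoid (DoubleTuple n) := ⟨BlockEquiv, blockEquiv_equivalence⟩

/-- The orbit `{P_σ : σ ∈ S_n}` modulo the above identification. -/
def varsOrbit (P : DoubleTuple n) : Set (Quotient (blockSetoid n)) :=
  Set.range fun σ : Equiv.Perm (Fin n) => Quotient.mk (blockSetoid n) (P.permVars σ)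

/-- The orbit `{P^σ : σ ∈ S_n}` (without any identification). -/
def expsOrbit (P : DoubleTuple n) : Set (DoubleTuple n) :=
  Set.range fun σ : Equiv.Perm (Fin n) => P.permExps σ

/-- The family `R_1, …, R_m` enumerates, without repetition, the orbit `{P_σ : σ ∈ S_n}` modulo
the identification: each `R_i` represents a class, and each class of the orbit is represented by
exactly one `R_i`. -/
def EnumeratesVarsOrbit (P : DoubleTuple n) {m : ℕ} (R : Fin m → DoubleTuple n) : Prop :=
  Function.Injective (fun i => Quotient.mk (blockSetoid n) (R i)) ∧
    Set.range (fun i => Quotient.mk (blockSetoid n) (R i)) = P.varsOrbit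

end DoubleTuple

section MixedNorm

variable {n : ℕ} {X : Fin n → Type*} [∀ i, MeasurableSpace (X i)]

/-- The `L^p` norm of `f` in the single variable `x_i`, the other variables being fixed. The result
is written as a function of all the variables, but it does not depend on `x_i`. -/
noncomputable def partialNorm (μ : ∀ i, Measure (X i)) (i : Fin n) (p : ℝ≥0∞)
    (f : (∀ i, X i) → ℝ≥0∞) : (∀ i, X i) → ℝ≥0∞ :=
  fun x => eLpNorm (fun t : X i => f (Function.update x i t)) p (μ i)

/-- The norms prescribed by the columns of `P`, taken successively, the first column first
(innermost). No dependence on any variable is left. -/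
noncomputable def iteratedNorm (μ : ∀ i, Measure (X i)) (P : DoubleTuple n)
    (f : (∀ i, X i) → ℝ≥0∞) : (∀ i, X i) → ℝ≥0∞ :=
  (List.finRange n).foldl (fun g j => partialNorm μ (P.vars j) (P.exps j) g) f

/-- The mixed norm `‖f‖_P`, that is, the value of the constant function `iteratedNorm μ P f`.
The supremum only serves to extract this value; it is `0` if the product space is empty. -/
noncomputable def mixedNorm (μ : ∀ i, Measure (X i)) (P : DoubleTuple n)
    (f : (∀ i, X i) → ℝ≥0∞) : ℝ≥0∞ :=
  ⨆ x, iteratedNorm μ P f x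

end MixedNorm

/-! ### Minkowski and Hölder inequalities for extended exponents -/

section TwoVariables

variable {α β : Type*} [MeasurableSpace α] [MeasurableSpace β]

/-! Record a tuple in the orbit by the function `varExps` sending each variable to its exponent.
Since the exponents decrease, equal ones are adjacent, so a class is exactly such a function, and
the classes correspond to the distinct rearrangements of the exponents; this gives the count
(`blockEquiv_iff`, `range_varExps`).

For the inequality, Minkowski says that taking larger exponents first gives the larger norm. Hence
each `‖f_i‖_{P_i}` dominates the norm with the same exponent on each variable but taken in one
common order (`iterNorm_le_of_perm`). Hölder then applies one variable at a time
(`iterNorm_prod_rpow_le`), and the exponent it produces in `x_k` has as reciprocal the average over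
`i` of the reciprocal exponents of `x_k`. By symmetry of the orbit this average does not depend on
`k`, so it is `1 / p̄` (`inv_harmonicMean`). An iterated norm with constant exponent bounds the norm
on the product space. -/

open Filter Topology in
/-- On a `σ`-finite space, `∫ g ^ r` is controlled by the finite integrals `∫ h ^ r` with `h ≤ g`
finite valued. -/
theorem lintegral_rpow_le_of_forall_le {μ : Measure α} [SigmaFinite μ] {g : α → ℝ≥0∞}
    (hg : Measurable g) {r : ℝ} (hr : 0 < r) {C : ℝ≥0∞}
    (h : ∀ k : α → ℝ≥0∞, Measurable k → (∀ x, k x ≤ g x) → (∀ x, k x ≠ ∞) →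
      ∫⁻ x, k x ^ r ∂μ ≠ ∞ → ∫⁻ x, k x ^ r ∂μ ≤ C) :
    ∫⁻ x, g x ^ r ∂μ ≤ C := by
  let S := spanningSets μ
  -- Truncate in height and in support; monotone convergence recovers `g`.
  let k : ℕ → α → ℝ≥0∞ := fun N => (S N).indicator fun x => min (g x) N
  have hkm : ∀ N, Measurable (k N) := fun N =>
    (hg.min measurable_const).indicator (measurableSet_spanningSets μ N)
  have hkN : ∀ N x, k N x ≤ (S N).indicator (fun _ => (N : ℝ≥0∞)) x := fun N x =>
    Set.indicator_le_indicator (min_le_right _ _)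
  have hlim : Tendsto (fun N => ∫⁻ x, k N x ^ r ∂μ) atTop (𝓝 (∫⁻ x, g x ^ r ∂μ)) := by
    refine lintegral_tendsto_of_tendsto_of_monotone (fun N => ((hkm N).pow_const r).aemeasurable)
      (ae_of_all _ fun x M N hMN => ?_) (ae_of_all _ fun x => ?_)
    · refine ENNReal.rpow_le_rpow ?_ hr.le
      refine (Set.indicator_le_indicator_of_subset (f := fun x => min (g x) (M : ℝ≥0∞))
        (monotone_spanningSets μ hMN) (fun _ => zero_le) x).trans (Set.indicator_le_indicator ?_)
      exact min_le_min le_rfl (by exact_mod_cast hMN)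
    · refine ((ENNReal.continuous_rpow_const (y := r)).tendsto _).comp ?_
      have h1 : Tendsto (fun N : ℕ => min (g x) (N : ℝ≥0∞)) atTop (𝓝 (min (g x) ∞)) :=
        tendsto_const_nhds.min ENNReal.tendsto_nat_nhds_top
      rw [min_eq_left le_top] at h1
      refine h1.congr' ?_
      filter_upwards [eventually_ge_atTop (spanningSetsIndex μ x)] with N hN
      have hx : x ∈ S N := monotone_spanningSets μ hN (mem_spanningSetsIndex μ x)
      simp [k, hx]
  refine le_of_tendsto' hlim fun N => h _ (hkm N) (fun x => ?_) (fun x => ?_) ?_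
  · by_cases hx : x ∈ S N <;> simp [k, hx]
  · refine ne_top_of_le_ne_top ?_ (hkN N x)
    by_cases hx : x ∈ S N <;> simp [hx]
  · have hle : ∫⁻ x, k N x ^ r ∂μ ≤ ∫⁻ x, (S N).indicator (fun _ => (N : ℝ≥0∞) ^ r) x ∂μ := by
      refine lintegral_mono fun x => (ENNReal.rpow_le_rpow (hkN N x) hr.le).trans ?_
      by_cases hx : x ∈ S N <;> simp [hx, hr]
    refine ne_top_of_le_ne_top ?_ hle
    rw [lintegral_indicator_const (measurableSet_spanningSets μ N)]
    exact ENNReal.mul_ne_top (by simp [hr.le]) (measure_spanningSets_lt_top μ N).ne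

/-- **Minkowski's integral inequality**. -/
theorem lintegral_rpow_lintegral_le {μ : Measure α} {ν : Measure β} [SigmaFinite μ] [SigmaFinite ν]
    {F : α → β → ℝ≥0∞} (hF : Measurable (Function.uncurry F)) {r : ℝ} (hr : 1 ≤ r) :
    (∫⁻ x, (∫⁻ y, F x y ∂ν) ^ r ∂μ) ^ (1 / r) ≤ ∫⁻ y, (∫⁻ x, F x y ^ r ∂μ) ^ (1 / r) ∂ν := by
  rcases hr.eq_or_lt with rfl | hr
  · simpa using (lintegral_lintegral_swap hF.aemeasurable).le
  have hr0 : 0 < r := one_pos.trans hr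
  set A := ∫⁻ y, (∫⁻ x, F x y ^ r ∂μ) ^ (1 / r) ∂ν with hA
  have hc := Real.HolderConjugate.conjExponent hr
  set s := Real.conjExponent r with hs
  have hG : Measurable fun x => ∫⁻ y, F x y ∂ν := hF.lintegral_prod_right'
  rw [one_div, ENNReal.rpow_inv_le_iff hr0]
  -- Duality: test the inner integral against `k ^ (r - 1)`. Finiteness of `∫ k ^ r` allows the
  -- cancellation at the end.
  refine lintegral_rpow_le_of_forall_le hG hr0 fun k hk hkG hkt hkI => ?_
  set I := ∫⁻ x, k x ^ r ∂μ with hI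
  have hFx : ∀ y, Measurable fun x => F x y := fun y => hF.comp measurable_prodMk_right
  have hk' : Measurable fun x => k x ^ (r - 1) := hk.pow_const _
  have key : I ≤ A * I ^ (1 / s) := by
    calc I ≤ ∫⁻ x, ∫⁻ y, F x y * k x ^ (r - 1) ∂ν ∂μ := by
          refine lintegral_mono fun x => ?_
          simp only
          rw [lintegral_mul_const _ (f := fun y => F x y) (hF.comp measurable_prodMk_left)]
          rcases eq_or_ne (k x) 0 with h0 | h0
          · simp [h0, hr0]
          · calc k x ^ r = k x * k x ^ (r - 1) := by
                  conv_lhs => rw [show r = 1 + (r - 1) by ring]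
                  rw [ENNReal.rpow_add _ _ h0 (hkt x), ENNReal.rpow_one]
              _ ≤ _ := by gcongr; exact hkG x
      _ = ∫⁻ y, ∫⁻ x, F x y * k x ^ (r - 1) ∂μ ∂ν :=
          lintegral_lintegral_swap (hF.mul (hk'.comp measurable_fst)).aemeasurable
      _ ≤ ∫⁻ y, (∫⁻ x, F x y ^ r ∂μ) ^ (1 / r) * I ^ (1 / s) ∂ν := by
          refine lintegral_mono fun y => ?_
          refine (ENNReal.lintegral_mul_le_Lp_mul_Lq μ hc (hFx y).aemeasurable
            hk'.aemeasurable).trans_eq ?_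
          simp_rw [← ENNReal.rpow_mul, hc.sub_one_mul_conj]
          rfl
      _ = A * I ^ (1 / s) := by
          refine lintegral_mul_const _ (Measurable.pow_const ?_ _)
          exact (hF.pow_const r).lintegral_prod_left'
  rcases eq_or_ne I 0 with h0 | h0
  · simp [h0]
  · rw [← ENNReal.rpow_inv_le_iff hr0]
    have h1 : I ^ (1 / s) ≠ 0 := by simp [h0, hkI]
    have h2 : I ^ (1 / s) ≠ ∞ := ENNReal.rpow_ne_top_of_nonneg (one_div_nonneg.2 hc.symm.nonneg) hkI
    -- Since `1 / r + 1 / s = 1`, multiplying by `I ^ (1 / s)` turns the goal into `key`.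
    rw [← ENNReal.mul_le_mul_iff_left h1 h2]
    refine le_trans (le_of_eq ?_) key
    rw [← ENNReal.rpow_add _ _ h0 hkI, one_div, hc.inv_add_inv_eq_one, ENNReal.rpow_one]

/-- For `p = ∞` the essential supremum exceeds `c` exactly when the section of `{F > c}` has nonzero
measure, which is measurable in `x`; for finite nonzero `p` this is Tonelli. -/
theorem measurable_eLpNorm_right {ν : Measure β} [SFinite ν] (p : ℝ≥0∞)
    {F : α → β → ℝ≥0∞} (hF : Measurable (Function.uncurry F)) :
    Measurable fun x => eLpNorm (F x) p ν := by
  rcases eq_or_ne p 0 with rfl | h0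
  · simp
  rcases eq_or_ne p ∞ with rfl | ht
  · refine measurable_of_Ioi fun c => ?_
    have : (fun x => eLpNorm (F x) ∞ ν) ⁻¹' Set.Ioi c = {x | ν {y | c < F x y} = 0}ᶜ := by
      ext x
      simp only [Set.mem_preimage, Set.mem_Ioi, Set.mem_compl_iff, Set.mem_ofPred_eq,
        eLpNorm_exponent_top, eLpNormEssSup, enorm_eq_self]
      rw [← not_le, not_iff_not]
      have : ν {y | c < F x y} = 0 ↔ ∀ᵐ y ∂ν, F x y ≤ c := by simp [ae_iff]
      rw [this]
      exact ⟨fun h => (ENNReal.ae_le_essSup _).mono fun y hy => hy.trans h,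
        fun h => essSup_le_of_ae_le _ h⟩
    rw [this]
    exact (measurable_measure_prodMk_left (hF measurableSet_Ioi)
      (measurableSet_singleton (0 : ℝ≥0∞))).compl
  · simp_rw [eLpNorm_eq_lintegral_rpow_enorm_toReal h0 ht, enorm_eq_self]
    exact (hF.pow_const _).lintegral_prod_right'.pow_const _

theorem eLpNorm_top_le_iff {ν : Measure β} {f : β → ℝ≥0∞} {C : ℝ≥0∞} :
    eLpNorm f ∞ ν ≤ C ↔ ∀ᵐ y ∂ν, f y ≤ C := by
  simp only [eLpNorm_exponent_top, eLpNormEssSup, enorm_eq_self]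
  exact ⟨fun h => (ENNReal.ae_le_essSup _).mono fun y hy => hy.trans h,
    fun h => essSup_le_of_ae_le _ h⟩

/-- Minkowski's inequality for mixed norms in two variables: taking the larger exponent
first gives the larger norm. -/
theorem eLpNorm_eLpNorm_swap_le {μ : Measure α} {ν : Measure β} [SigmaFinite μ] [SigmaFinite ν]
    {F : α → β → ℝ≥0∞} (hF : Measurable (Function.uncurry F)) {p q : ℝ≥0∞} (hq : 0 < q)
    (hqp : q ≤ p) :
    eLpNorm (fun x => eLpNorm (fun y => F x y) q ν) p μ
      ≤ eLpNorm (fun y => eLpNorm (fun x => F x y) p μ) q ν := by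
  have hF' : Measurable (Function.uncurry fun y x => F x y) := hF.comp measurable_swap
  rcases eq_or_ne p ∞ with rfl | hp
  · rw [eLpNorm_top_le_iff]
    have h1 : ∀ᵐ y ∂ν, ∀ᵐ x ∂μ, F x y ≤ eLpNorm (fun x => F x y) ∞ μ :=
      ae_of_all _ fun y => eLpNorm_top_le_iff.1 le_rfl
    have hm : MeasurableSet {z : α × β | F z.1 z.2 ≤ eLpNorm (fun x => F x z.2) ∞ μ} :=
      measurableSet_le hF ((measurable_eLpNorm_right ∞ hF').comp measurable_snd)
    have h2 : ∀ᵐ x ∂μ, ∀ᵐ y ∂ν, F x y ≤ eLpNorm (fun x => F x y) ∞ μ :=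
      (Measure.ae_ae_comm hm).2 h1
    exact h2.mono fun x hx => eLpNorm_mono_enorm_ae hx
  · have hqt : q ≠ ∞ := ne_top_of_le_ne_top hp hqp
    have hp0 : p ≠ 0 := (hq.trans_le hqp).ne'
    have hqr : 0 < q.toReal := ENNReal.toReal_pos hq.ne' hqt
    have hpr : 0 < p.toReal := ENNReal.toReal_pos hp0 hp
    have hr : 1 ≤ p.toReal / q.toReal := by
      rw [one_le_div hqr]
      exact ENNReal.toReal_mono hp hqp
    -- Minkowski for `F ^ q` with exponent `p / q ≥ 1`; the rest is bookkeeping of powers.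
    have key := lintegral_rpow_lintegral_le (μ := μ) (ν := ν) (F := fun x y => F x y ^ q.toReal)
      (hF.pow_const _) hr
    simp_rw [eLpNorm_eq_lintegral_rpow_enorm_toReal hq.ne' hqt,
      eLpNorm_eq_lintegral_rpow_enorm_toReal hp0 hp, enorm_eq_self]
    simp_rw [← ENNReal.rpow_mul] at key ⊢
    have e1 : q.toReal * (p.toReal / q.toReal) = p.toReal := by field_simp
    have e2 : 1 / q.toReal * p.toReal = p.toReal / q.toReal := by field_simp
    have e3 : 1 / p.toReal * q.toReal = 1 / (p.toReal / q.toReal) := by field_simp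
    have e4 : 1 / p.toReal = 1 / (p.toReal / q.toReal) * (1 / q.toReal) := by field_simp
    rw [e2, e3, e4, ENNReal.rpow_mul]
    rw [e1] at key
    exact ENNReal.rpow_le_rpow key (by positivity)

/-- **Hölder's inequality** for a geometric mean of finitely many functions whose exponents have
harmonic mean `q`. -/
theorem eLpNorm_prod_rpow_le {ι : Type*} [Fintype ι] {ν : Measure β} {f : ι → β → ℝ≥0∞}
    (hf : ∀ i, AEMeasurable (f i) ν) {w : ℝ} (hw : 0 < w) {e : ι → ℝ≥0∞} (he : ∀ i, e i ≠ 0)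
    {q : ℝ≥0∞} (hq : q⁻¹ = ENNReal.ofReal w * ∑ i, (e i)⁻¹) :
    eLpNorm (fun y => ∏ i, f i y ^ w) q ν ≤ ∏ i, eLpNorm (f i) (e i) ν ^ w := by
  have hw' : ENNReal.ofReal w ≠ 0 := by simpa using hw
  have hq0 : q ≠ 0 := by
    rw [← ENNReal.inv_ne_top, hq]
    exact ENNReal.mul_ne_top ENNReal.ofReal_ne_top
      (ENNReal.sum_ne_top.2 fun i _ => ENNReal.inv_ne_top.2 (he i))
  have htop : ∀ i, e i = ∞ → ∀ᵐ y ∂ν, f i y ≤ eLpNorm (f i) (e i) ν := fun i hi => by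
    rw [hi]; exact eLpNorm_top_le_iff.1 le_rfl
  rcases eq_or_ne q ∞ with rfl | hqt
  · have hall : ∀ i, e i = ∞ := by
      simpa [hw'] using hq.symm
    rw [eLpNorm_top_le_iff]
    filter_upwards [ae_all_iff.2 fun i => htop i (hall i)] with y hy
    exact Finset.prod_le_prod' fun i _ => ENNReal.rpow_le_rpow (hy i) hw.le
  · classical
    have hqr : 0 < q.toReal := ENNReal.toReal_pos hq0 hqt
    have hqreal : q.toReal⁻¹ = w * ∑ i, (e i).toReal⁻¹ := by
      have := congrArg ENNReal.toReal hq
      rw [ENNReal.toReal_mul, ENNReal.toReal_ofReal hw.le,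
        ENNReal.toReal_sum fun i _ => ENNReal.inv_ne_top.2 (he i)] at this
      simpa [ENNReal.toReal_inv] using this
    -- Factors with infinite exponent are bounded a.e. by their norms and leave the integral as the
    -- constant `M`; the others obey Hölder with weights `v i`, which sum to 1.
    set T : Finset ι := Finset.univ.filter fun i => e i ≠ ∞ with hT
    set M : ℝ≥0∞ := ∏ i ∈ Tᶜ, eLpNorm (f i) (e i) ν ^ (w * q.toReal) with hM
    set v : ι → ℝ := fun i => w * q.toReal / (e i).toReal with hv
    have hsum : ∑ i ∈ T, v i = 1 := by
      have h1 : ∑ i ∈ T, v i = ∑ i, v i := by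
        refine Finset.sum_subset (Finset.subset_univ _) fun i _ hi => ?_
        have : e i = ∞ := by simpa [hT] using hi
        simp [hv, this]
      rw [h1]
      simp only [hv, div_eq_mul_inv]
      rw [← Finset.mul_sum, mul_right_comm, ← hqreal, inv_mul_cancel₀ hqr.ne']
    have hpos : ∀ i ∈ T, 0 < (e i).toReal := fun i hi =>
      ENNReal.toReal_pos (he i) (by simpa [hT] using hi)
    rw [eLpNorm_eq_lintegral_rpow_enorm_toReal hq0 hqt, one_div,
      ENNReal.rpow_inv_le_iff hqr]
    simp_rw [enorm_eq_self]
    calc ∫⁻ y, (∏ i, f i y ^ w) ^ q.toReal ∂ν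
        ≤ ∫⁻ y, M * ∏ i ∈ T, (f i y ^ (e i).toReal) ^ v i ∂ν := by
          refine lintegral_mono_ae ?_
          have : ∀ᵐ y ∂ν, ∀ i, e i = ∞ → f i y ≤ eLpNorm (f i) (e i) ν :=
            ae_all_iff.2 fun i => by
              by_cases hi : e i = ∞
              · exact (htop i hi).mono fun y hy _ => hy
              · exact ae_of_all _ fun y h => absurd h hi
          filter_upwards [this] with y hy
          rw [← ENNReal.prod_rpow_of_nonneg hqr.le, ← Finset.prod_compl_mul_prod T]
          refine mul_le_mul' (Finset.prod_le_prod' fun i hi => ?_) (Finset.prod_le_prod' fun i hi => ?_)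
          · rw [← ENNReal.rpow_mul]
            exact ENNReal.rpow_le_rpow (hy i (by simpa [hT] using hi)) (by positivity)
          · rw [← ENNReal.rpow_mul, ← ENNReal.rpow_mul]
            refine le_of_eq (congrArg _ ?_)
            have := hpos i hi
            simp only [hv]; field_simp
      _ = M * ∫⁻ y, ∏ i ∈ T, (f i y ^ (e i).toReal) ^ v i ∂ν := by
          refine lintegral_const_mul'' _ ?_
          exact Finset.aemeasurable_fun_prod T fun i _ => ((hf i).pow_const _).pow_const _
      _ ≤ M * ∏ i ∈ T, (∫⁻ y, f i y ^ (e i).toReal ∂ν) ^ v i := by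
          gcongr
          exact ENNReal.lintegral_prod_norm_pow_le T (fun i _ => (hf i).pow_const _) hsum
            fun i _ => by positivity
      _ = (∏ i, eLpNorm (f i) (e i) ν ^ w) ^ q.toReal := by
          rw [← ENNReal.prod_rpow_of_nonneg hqr.le, ← Finset.prod_compl_mul_prod T]
          congr 1
          · exact Finset.prod_congr rfl fun i _ => ENNReal.rpow_mul _ _ _
          · refine Finset.prod_congr rfl fun i hi => ?_
            have := hpos i hi
            rw [eLpNorm_eq_lintegral_rpow_enorm_toReal (he i) (by simpa [hT] using hi),
              ← ENNReal.rpow_mul, ← ENNReal.rpow_mul]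
            simp_rw [enorm_eq_self]
            refine congrArg _ ?_
            simp only [hv]; field_simp

end TwoVariables

/-! ### Iterated norms in several variables -/

section IterNorm

variable {n : ℕ} {X : Fin n → Type*} [∀ i, MeasurableSpace (X i)]

/-- The `L^{e k}` norms in the variables `x_k`, taken successively for `k` in the list `L`, the head
of the list first. -/
noncomputable def iterNorm (μ : ∀ i, Measure (X i)) (e : Fin n → ℝ≥0∞) (L : List (Fin n))
    (f : (∀ i, X i) → ℝ≥0∞) : (∀ i, X i) → ℝ≥0∞ :=
  L.foldl (fun g k => partialNorm μ k (e k) g) f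

variable {μ : ∀ i, Measure (X i)} {e : Fin n → ℝ≥0∞}

@[simp]
theorem iterNorm_nil (f : (∀ i, X i) → ℝ≥0∞) : iterNorm μ e [] f = f := rfl

@[simp]
theorem iterNorm_cons (k : Fin n) (L : List (Fin n)) (f : (∀ i, X i) → ℝ≥0∞) :
    iterNorm μ e (k :: L) f = iterNorm μ e L (partialNorm μ k (e k) f) := rfl

theorem iteratedNorm_eq_iterNorm (P : DoubleTuple n) (f : (∀ i, X i) → ℝ≥0∞) :
    iteratedNorm μ P f
      = iterNorm μ (fun k => P.exps (P.vars⁻¹ k)) ((List.finRange n).map P.vars) f := by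
  simp [iteratedNorm, iterNorm, List.foldl_map]

theorem partialNorm_mono (k : Fin n) (p : ℝ≥0∞) {f g : (∀ i, X i) → ℝ≥0∞} (h : f ≤ g) :
    partialNorm μ k p f ≤ partialNorm μ k p g :=
  fun _ => eLpNorm_mono_enorm fun _ => h _

theorem iterNorm_mono (L : List (Fin n)) {f g : (∀ i, X i) → ℝ≥0∞} (h : f ≤ g) :
    iterNorm μ e L f ≤ iterNorm μ e L g := by
  induction L generalizing f g with
  | nil => exact h
  | cons k L ih => exact ih (partialNorm_mono k _ h)

variable [∀ i, SigmaFinite (μ i)]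

theorem measurable_partialNorm (k : Fin n) (p : ℝ≥0∞) {f : (∀ i, X i) → ℝ≥0∞} (hf : Measurable f) :
    Measurable (partialNorm μ k p f) :=
  measurable_eLpNorm_right (F := fun x t => f (Function.update x k t)) p
    (hf.comp measurable_update')

theorem partialNorm_swap_le {k l : Fin n} (hl : 0 < e l) (hkl : e l ≤ e k)
    {f : (∀ i, X i) → ℝ≥0∞} (hf : Measurable f) :
    partialNorm μ k (e k) (partialNorm μ l (e l) f)
      ≤ partialNorm μ l (e l) (partialNorm μ k (e k) f) := by
  rcases eq_or_ne k l with rfl | hne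
  · exact le_rfl
  intro x
  have hm : Measurable (Function.uncurry fun (t : X k) (s : X l) =>
      f (Function.update (Function.update x k t) l s)) :=
    hf.comp (measurable_update'.comp
      (((measurable_update x).comp measurable_fst).prodMk measurable_snd))
  refine (eLpNorm_eLpNorm_swap_le (μ := μ k) (ν := μ l) hm hl hkl).trans_eq ?_
  simp only [partialNorm, Function.update_comm hne]

/-- Each adjacent swap moves the smaller exponent outward, and so is one use of Minkowski. -/
theorem iterNorm_cons_append_le {a : Fin n} (ha : 0 < e a) (L₁ L₂ : List (Fin n))
    (h : ∀ b ∈ L₁, e a ≤ e b) {f : (∀ i, X i) → ℝ≥0∞} (hf : Measurable f) :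
    iterNorm μ e (a :: (L₁ ++ L₂)) f ≤ iterNorm μ e (L₁ ++ a :: L₂) f := by
  induction L₁ generalizing f with
  | nil => exact le_rfl
  | cons b L₁ ih =>
    refine le_trans ?_ (ih (fun c hc => h c (List.mem_cons_of_mem _ hc))
      (measurable_partialNorm b (e b) hf))
    exact iterNorm_mono _ (partialNorm_swap_le ha (h b List.mem_cons_self) hf)

/-- Taking the norms in the order of decreasing exponents gives the largest mixed norm. -/
theorem iterNorm_le_of_perm (he : ∀ k, 0 < e k) {L L' : List (Fin n)} (hL : L'.Perm L)
    (hs : L.Pairwise fun a b => e b ≤ e a) {f : (∀ i, X i) → ℝ≥0∞} (hf : Measurable f) :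
    iterNorm μ e L' f ≤ iterNorm μ e L f := by
  induction L' generalizing L f with
  | nil => rw [hL.nil_eq]
  | cons a L' ih =>
    -- Insertion sort: the tail is sorted by induction, then `a` moves outward past `L₁`, whose
    -- exponents are at least `e a`.
    obtain ⟨L₁, L₂, rfl⟩ := List.append_of_mem (hL.subset List.mem_cons_self)
    have hp : L'.Perm (L₁ ++ L₂) := (List.perm_cons a).1 (hL.trans List.perm_middle)
    obtain ⟨h₁, h₂, h₁₂⟩ := List.pairwise_append.1 hs
    refine (ih hp ?_ (measurable_partialNorm a (e a) hf)).trans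
      (iterNorm_cons_append_le (he a) L₁ L₂ (fun b hb => h₁₂ b hb a List.mem_cons_self) hf)
    exact List.pairwise_append.2 ⟨h₁, h₂.of_cons, fun b hb c hc =>
      h₁₂ b hb c (List.mem_cons_of_mem _ hc)⟩

/-- **Hölder's inequality** for mixed norms taken in the same order of the variables. -/
theorem iterNorm_prod_rpow_le {ι : Type*} [Fintype ι] {e : ι → Fin n → ℝ≥0∞}
    (he : ∀ i k, e i k ≠ 0) {w : ℝ} (hw : 0 < w) {q : Fin n → ℝ≥0∞}
    (hq : ∀ k, (q k)⁻¹ = ENNReal.ofReal w * ∑ i, (e i k)⁻¹) (L : List (Fin n))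
    {f : ι → (∀ j, X j) → ℝ≥0∞} (hf : ∀ i, Measurable (f i)) :
    iterNorm μ q L (fun x => ∏ i, f i x ^ w)
      ≤ fun x => ∏ i, iterNorm μ (e i) L (f i) x ^ w := by
  induction L generalizing f with
  | nil => exact le_rfl
  | cons k L ih =>
    refine le_trans (iterNorm_mono L fun x => ?_)
      (ih fun i => measurable_partialNorm k (e i k) (hf i))
    exact eLpNorm_prod_rpow_le (fun i => ((hf i).comp (measurable_update x)).aemeasurable) hw
      (fun i => he i k) (hq k)

theorem iterNorm_rpow_eq_lmarginal {q : ℝ≥0∞} (hq0 : q ≠ 0) (hqt : q ≠ ∞) {L : List (Fin n)}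
    (hL : L.Nodup) {f : (∀ j, X j) → ℝ≥0∞} (hf : Measurable f) (x : ∀ j, X j) :
    iterNorm μ (fun _ => q) L f x ^ q.toReal
      = (∫⋯∫⁻_L.toFinset, (fun y => f y ^ q.toReal) ∂μ) x := by
  have hq := ENNReal.toReal_pos hq0 hqt
  induction L generalizing f with
  | nil => simp
  | cons k L ih =>
    obtain ⟨hk, hL⟩ := List.nodup_cons.1 hL
    rw [iterNorm_cons, ih hL (measurable_partialNorm k q hf), List.toFinset_cons,
      lmarginal_insert' _ (hf.pow_const _) (by simpa using hk)]
    congr 1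
    funext y
    rw [partialNorm, eLpNorm_eq_lintegral_rpow_enorm_toReal hq0 hqt, ← ENNReal.rpow_mul,
      one_div_mul_cancel hq.ne', ENNReal.rpow_one]
    simp_rw [enorm_eq_self]

/-- An iterated essential supremum at most `C` makes `{C < f}` null, by Fubini for null sets. The
indicator form lets the induction integrate one variable at a time. -/
theorem lmarginal_indicator_eq_zero_of_iterNorm_top_le {C : ℝ≥0∞} {L : List (Fin n)}
    (hL : L.Nodup) {f : (∀ j, X j) → ℝ≥0∞} (hf : Measurable f)
    (h : ∀ x, iterNorm μ (fun _ => ∞) L f x ≤ C) :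
    (∫⋯∫⁻_L.toFinset, ({x | C < f x}.indicator 1) ∂μ) = 0 := by
  induction L generalizing f with
  | nil =>
    funext x
    simpa using h x
  | cons k L ih =>
    obtain ⟨hk, hL⟩ := List.nodup_cons.1 hL
    have hm : Measurable ({x | C < f x}.indicator (1 : (∀ j, X j) → ℝ≥0∞)) :=
      measurable_one.indicator (measurableSet_lt measurable_const hf)
    have hm' := measurable_partialNorm (μ := μ) k ∞ hf
    have hmi : Measurable ({x | C < partialNorm μ k ∞ f x}.indicator (1 : (∀ j, X j) → ℝ≥0∞)) :=
      measurable_one.indicator (measurableSet_lt measurable_const hm')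
    rw [List.toFinset_cons, lmarginal_insert' _ hm (by simpa using hk)]
    -- The section is null where the partial norm is at most `C`; elsewhere the bound `∞` suffices,
    -- since `∞ * 0 = 0` after integration.
    have key : (fun x => ∫⁻ t, {x | C < f x}.indicator 1 (Function.update x k t) ∂μ k)
        ≤ fun x => ∞ * {x | C < partialNorm μ k ∞ f x}.indicator 1 x := by
      intro x
      by_cases hx : C < partialNorm μ k ∞ f x
      · simp [hx]
      · have : ∀ᵐ t ∂μ k, f (Function.update x k t) ≤ C := eLpNorm_top_le_iff.1 (not_lt.1 hx)
        refine (lintegral_eq_zero_of_ae_eq_zero ?_).trans_le zero_le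
        filter_upwards [this] with t ht
        simp [ht]
    funext x
    refine le_antisymm ((lmarginal_mono key x).trans ?_) zero_le
    have h0 := congrFun (ih hL hm' h) x
    simp only [lmarginal] at h0 ⊢
    refine (lintegral_const_mul _ (hmi.comp measurable_updateFinset)).trans_le ?_
    simp only [Function.comp_apply]
    rw [h0]
    simp

/-- The `L^q` norm on the product space is bounded by the iterated `L^q` norm. -/
theorem eLpNorm_pi_le_of_iterNorm_le [Nonempty (∀ j, X j)] {q : ℝ≥0∞} {C : ℝ≥0∞}
    {L : List (Fin n)} (hL : L.Nodup) (hL' : ∀ k, k ∈ L) {f : (∀ j, X j) → ℝ≥0∞}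
    (hf : Measurable f) (h : ∀ x, iterNorm μ (fun _ => q) L f x ≤ C) :
    eLpNorm f q (Measure.pi μ) ≤ C := by
  have hu : L.toFinset = Finset.univ := by ext; simp [hL']
  obtain ⟨x₀⟩ := ‹Nonempty (∀ j, X j)›
  rcases eq_or_ne q 0 with rfl | hq0
  · simp
  rcases eq_or_ne q ∞ with rfl | hqt
  · have h0 := congrFun (lmarginal_indicator_eq_zero_of_iterNorm_top_le hL hf h) x₀
    rw [hu, lmarginal_univ] at h0
    simp only at h0
    rw [lintegral_indicator_one (measurableSet_lt measurable_const hf)] at h0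
    rw [eLpNorm_top_le_iff, ae_iff]
    simpa using h0
  · have hq := ENNReal.toReal_pos hq0 hqt
    have h1 := iterNorm_rpow_eq_lmarginal (μ := μ) hq0 hqt hL hf x₀
    rw [hu, lmarginal_univ] at h1
    rw [eLpNorm_eq_lintegral_rpow_enorm_toReal hq0 hqt, one_div, ENNReal.rpow_inv_le_iff hq]
    simp_rw [enorm_eq_self]
    exact h1.symm.trans_le (ENNReal.rpow_le_rpow (h x₀) hq.le)

end IterNorm

/-! ### Combinatorics of the orbit -/

namespace DoubleTuple

variable {n : ℕ}

/-- The exponent that `P` assigns to the variable `x_k`. -/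
def varExps (P : DoubleTuple n) (k : Fin n) : ℝ≥0∞ := P.exps (P.vars⁻¹ k)

@[simp]
theorem varExps_vars (P : DoubleTuple n) (j : Fin n) : P.varExps (P.vars j) = P.exps j := by
  simp [varExps]

/-- Monotonicity makes positions with equal exponents contiguous, so a permutation preserving
exponents automatically stays within blocks. -/
theorem blockEquiv_iff {P Q : DoubleTuple n} (hP : Antitone P.exps) :
    BlockEquiv P Q ↔ P.exps = Q.exps ∧ P.varExps = Q.varExps := by
  refine and_congr_right fun h => ⟨?_, fun hv => ⟨P.vars⁻¹ * Q.vars, fun j k hk => ?_, by simp⟩⟩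
  · rintro ⟨τ, hτ, hQ⟩
    funext k
    obtain ⟨j, rfl⟩ := Q.vars.surjective k
    rw [varExps_vars, ← h, hQ, Equiv.Perm.mul_apply, varExps_vars]
    exact hτ j _ Set.right_mem_uIcc
  · set i := (P.vars⁻¹ * Q.vars) j with hi
    have hij : P.exps i = P.exps j := by
      have h1 := congrFun hv (Q.vars j)
      rw [varExps_vars, ← h] at h1
      exact h1
    rcases Set.mem_uIcc.1 hk with ⟨h1, h2⟩ | ⟨h1, h2⟩
    · exact le_antisymm (hP h1) (hij.symm.trans_le (hP h2))
    · exact le_antisymm ((hP h1).trans_eq hij) (hP h2)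

section Enumeration

variable {P : DoubleTuple n} {m : ℕ} {R : Fin m → DoubleTuple n}

theorem EnumeratesVarsOrbit.exps_eq (hR : P.EnumeratesVarsOrbit R) (i : Fin m) :
    (R i).exps = P.exps := by
  have hi : Quotient.mk (blockSetoid n) (R i) ∈ P.varsOrbit := hR.2 ▸ Set.mem_range_self i
  obtain ⟨σ, hσ⟩ := hi
  have h : BlockEquiv (P.permVars σ) (R i) := Quotient.exact hσ
  exact h.1.symm

theorem EnumeratesVarsOrbit.varExps_injective (hP : Antitone P.exps)
    (hR : P.EnumeratesVarsOrbit R) : Function.Injective fun i => (R i).varExps := by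
  intro i j hij
  refine hR.1 (Quotient.sound ?_)
  change BlockEquiv (R i) (R j)
  exact (blockEquiv_iff (by rwa [hR.exps_eq])).2 ⟨by simp [hR.exps_eq], hij⟩

theorem EnumeratesVarsOrbit.range_varExps (hP : Antitone P.exps) (hR : P.EnumeratesVarsOrbit R) :
    (Set.range fun i => (R i).varExps) = Set.range fun σ : Equiv.Perm (Fin n) => P.exps ∘ σ := by
  ext g
  constructor
  · rintro ⟨i, rfl⟩
    exact ⟨(R i).vars⁻¹, by funext k; simp [varExps, hR.exps_eq]⟩
  · rintro ⟨σ, rfl⟩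
    -- The bottom row of this tuple is `σ⁻¹`, so `x_k` receives the exponent `P.exps (σ k)`.
    have hmem : Quotient.mk (blockSetoid n) (P.permVars (P.vars⁻¹ * σ⁻¹)) ∈ P.varsOrbit :=
      Set.mem_range_self _
    rw [← hR.2] at hmem
    obtain ⟨i, hi⟩ := hmem
    have h : BlockEquiv (R i) (P.permVars (P.vars⁻¹ * σ⁻¹)) := Quotient.exact hi
    refine ⟨i, ((blockEquiv_iff (by rwa [hR.exps_eq])).1 h).2.trans ?_⟩
    funext k
    simp [varExps, permVars]

theorem EnumeratesVarsOrbit.card_eq (hP : Antitone P.exps) (hR : P.EnumeratesVarsOrbit R) :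
    m = P.expsOrbit.ncard := by
  have h1 : exps '' P.expsOrbit = Set.range fun i => (R i).varExps := by
    rw [hR.range_varExps hP, expsOrbit, ← Set.range_comp]
    rfl
  have h2 : Set.InjOn exps P.expsOrbit := by
    rintro _ ⟨σ, rfl⟩ _ ⟨τ, rfl⟩ h
    exact DoubleTuple.ext h rfl
  rw [← h2.ncard_image, h1, ← Nat.card_coe_set_eq,
    Nat.card_range_of_injective (hR.varExps_injective hP), Nat.card_fin]

theorem EnumeratesVarsOrbit.pos (hP : Antitone P.exps) (hR : P.EnumeratesVarsOrbit R) : 0 < m := by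
  have h : P.exps ∘ (1 : Equiv.Perm (Fin n)) ∈ Set.range fun i => (R i).varExps := by
    rw [hR.range_varExps hP]
    exact Set.mem_range_self _
  obtain ⟨i, -⟩ := h
  exact i.pos

/-- By symmetry of the orbit, all variables have the same sum of reciprocal exponents. -/
theorem EnumeratesVarsOrbit.sum_inv_varExps_eq (hP : Antitone P.exps)
    (hR : P.EnumeratesVarsOrbit R) (k l : Fin n) :
    ∑ i, ((R i).varExps k)⁻¹ = ∑ i, ((R i).varExps l)⁻¹ := by
  classical
  let E : Finset (Fin n → ℝ≥0∞) := Finset.univ.image fun i => (R i).varExps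
  have hE : ∀ g, g ∈ E ↔ ∃ σ : Equiv.Perm (Fin n), P.exps ∘ σ = g := fun g => by
    have : g ∈ E ↔ g ∈ Set.range fun i => (R i).varExps := by simp [E]
    rw [this, hR.range_varExps hP]
    rfl
  have hsum : ∀ k, ∑ i, ((R i).varExps k)⁻¹ = ∑ g ∈ E, (g k)⁻¹ := fun k =>
    (Finset.sum_image (f := fun g : Fin n → ℝ≥0∞ => (g k)⁻¹)
      (hR.varExps_injective hP).injOn).symm
  have hmem : ∀ g ∈ E, g ∘ Equiv.swap k l ∈ E := by
    intro g hg
    obtain ⟨σ, rfl⟩ := (hE g).1 hg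
    exact (hE _).2 ⟨σ * Equiv.swap k l, rfl⟩
  have hinv : ∀ g ∈ E, (g ∘ Equiv.swap k l) ∘ Equiv.swap k l = g := fun g _ => by
    funext j; simp
  rw [hsum, hsum]
  exact Finset.sum_nbij' (· ∘ Equiv.swap k l) (· ∘ Equiv.swap k l) hmem hmem hinv hinv
    fun g _ => by simp

/-- Double counting in the array of all `1 / (R i).varExps k`: the `m` row sums all equal `∑ 1 /
p_j`, and the `n` column sums agree by symmetry. -/
theorem EnumeratesVarsOrbit.inv_harmonicMean (hP : Antitone P.exps)
    (hR : P.EnumeratesVarsOrbit R) (k : Fin n) :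
    P.harmonicMean⁻¹ = ENNReal.ofReal (1 / m) * ∑ i, ((R i).varExps k)⁻¹ := by
  have hn : (n : ℝ≥0∞) ≠ 0 := by exact_mod_cast k.pos.ne'
  have hm : (m : ℝ≥0∞) ≠ 0 := by exact_mod_cast (hR.pos hP).ne'
  have hrow : ∀ i, ∑ l, ((R i).varExps l)⁻¹ = ∑ j, (P.exps j)⁻¹ := fun i => by
    rw [← Equiv.sum_comp (R i).vars]
    simp [hR.exps_eq]
  have h : (n : ℝ≥0∞) * ∑ i, ((R i).varExps k)⁻¹ = m * ∑ j, (P.exps j)⁻¹ := by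
    calc (n : ℝ≥0∞) * ∑ i, ((R i).varExps k)⁻¹
        = ∑ l : Fin n, ∑ i, ((R i).varExps l)⁻¹ := by
          simp [hR.sum_inv_varExps_eq hP _ k]
      _ = ∑ i, ∑ l, ((R i).varExps l)⁻¹ := Finset.sum_comm
      _ = m * ∑ j, (P.exps j)⁻¹ := by simp [hrow]
  rw [harmonicMean, inv_inv, one_div, ENNReal.ofReal_inv_of_pos (by exact_mod_cast hR.pos hP),
    ENNReal.ofReal_natCast, ← ENNReal.mul_right_inj hn (ENNReal.natCast_ne_top n),
    mul_left_comm _ (m : ℝ≥0∞)⁻¹, h, ← mul_assoc, ← mul_assoc, ENNReal.mul_inv_cancel hn (ENNReal.natCast_ne_top n),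
    ENNReal.inv_mul_cancel hm (ENNReal.natCast_ne_top m)]

end Enumeration

end DoubleTuple

/-! ### Comparison with the natural order, and the main inequality -/

section

variable {n : ℕ} {X : Fin n → Type*} [∀ i, MeasurableSpace (X i)]
  {μ : ∀ i, Measure (X i)} [∀ i, SigmaFinite (μ i)]

/-- If the exponents of `P` decrease, then the mixed norm for `P` dominates the one with the same
exponents for each variable, taken in the natural order of the variables. -/
theorem iterNorm_finRange_le_mixedNorm (P : DoubleTuple n) (hP : Antitone P.exps)
    {f : (∀ j, X j) → ℝ≥0∞} (hf : Measurable f) (x : ∀ j, X j) :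
    iterNorm μ P.varExps (List.finRange n) f x ≤ mixedNorm μ P f := by
  refine le_trans ?_ (le_iSup (iteratedNorm μ P f) x)
  rw [iteratedNorm_eq_iterNorm]
  refine iterNorm_le_of_perm (e := P.varExps) (fun k => P.exps_pos _) ?_ ?_ hf x
  · refine (List.perm_ext_iff_of_nodup (List.nodup_finRange n)
      ((List.nodup_finRange n).map P.vars.injective)).2 fun k => ?_
    simpa using ⟨P.vars.symm k, by simp⟩
  · rw [List.pairwise_map]
    refine (List.pairwise_lt_finRange n).imp fun {a b} hab => ?_
    simpa using hP hab.le

end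

theorem corollary3p5 {n : ℕ} (hn : 0 < n) {X : Fin n → Type*} [∀ j, MeasurableSpace (X j)]
    (μ : ∀ j, Measure (X j)) [∀ j, SigmaFinite (μ j)]
    (P : DoubleTuple n) (hP : Antitone P.exps)
    {m : ℕ} (R : Fin m → DoubleTuple n) (hR : P.EnumeratesVarsOrbit R) :
    m = P.expsOrbit.ncard ∧
    ∀ f : Fin m → (∀ j, X j) → ℝ≥0∞, (∀ i, Measurable (f i)) →
      eLpNorm (fun x => ∏ i, f i x ^ (1 / (m : ℝ))) P.harmonicMean (Measure.pi μ)
        ≤ ∏ i, mixedNorm μ (R i) (f i) ^ (1 / (m : ℝ)) := by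
  refine ⟨hR.card_eq hP, fun f hf => ?_⟩
  have hm : 0 < 1 / (m : ℝ) := one_div_pos.2 (by exact_mod_cast hR.pos hP)
  -- On an empty product `mixedNorm` is the empty supremum `0`, but the left side vanishes as well.
  rcases isEmpty_or_nonempty (∀ j, X j) with hX | hX
  · rw [Measure.eq_zero_of_isEmpty (Measure.pi μ)]
    simp
  refine eLpNorm_pi_le_of_iterNorm_le (List.nodup_finRange n) List.mem_finRange
    (Finset.measurable_fun_prod _ fun i _ => (hf i).pow_const _) fun x => ?_
  refine (iterNorm_prod_rpow_le (e := fun i => (R i).varExps) (fun i k => ((R i).exps_pos _).ne')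
    hm (fun k => hR.inv_harmonicMean hP k) _ hf x).trans ?_
  refine Finset.prod_le_prod' fun i _ => ENNReal.rpow_le_rpow ?_ hm.le
  exact iterNorm_finRange_le_mixedNorm (R i) (by rwa [hR.exps_eq]) (hf i) x
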